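/- For integers $m,n$ and $q\ge 1$ let $$S(m,n;q)=\sum_{\substack{1\le d\le q\\ (d,q)=1}} e\!\left(\frac{md+n\overline d}{q}\right),\qquad e(x)=e^{2\pi i x},\quad d\overline d\equiv 1 \pmod q,$$ denote the Kloosterman sum. For a prime $N$, integers $n_1,n_2$ and a Dirichlet character $\chi$ modulo $N$ set $$K(n_1,n_2,\chi)=\sum_{\substack{1\le a\le N\\ (a,N)=1}}\chi(a)\,S(n_1,a;N)\,S(n_2,a;N).$$ (i) Let $N$ be a prime, let $n_1,n_2$ be integers, neither of which is divisible by $N$, and let $\chi_0$ be the principal character modulo $N$. Then $$K(n_1,n_2,\chi_0)=\begin{cases}\varphi(N)^2+\varphi(N)-1 & \text{if } n_1-n_2\equiv 0 \pmod N,\\ -\varphi(N)-2 & \text{otherwise,}\end{cases}$$ where $\varphi$ is Euler's totient function. (ii) For every $\epsilon>0$ there is a constant $C_\epsilon$, depending only on $\epsilon$, such that for every prime $N$, all integers $n_1,n_2$ neither of which is divisible by $N$, and every non-principal Dirichlet character $\chi$ modulo $N$, $$|K(n_1,n_2,\chi)|\le C_\epsilon\, N^{3/2+\epsilon}.$$ 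-/

import Mathlib

/-- The Kloosterman sum `S(m, n; q)`: the sum over reduced residues `d` modulo `q` of
`e((m * d + n * d⁻¹) / q)`, where `e(x) = exp(2 * π * i * x)` and `d⁻¹` is the inverse of `d`
modulo `q`. It only depends on `m` and `n` modulo `q`; `ZMod.stdAddChar` sends the class of an
integer `j` to `e(j / q)`. -/
noncomputable def kloostermanSum (q : ℕ) [NeZero q] (m n : ZMod q) : ℂ :=
  ∑ d : (ZMod q)ˣ,
    ZMod.stdAddChar (m * (d : ZMod q) + n * ((d⁻¹ : (ZMod q)ˣ) : ZMod q))

/-- The sum `K(n₁, n₂, χ)` over reduced residues `a` modulo `N` of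
`χ(a) S(n₁, a; N) S(n₂, a; N)`. -/
noncomputable def kloostermanCorrelation {N : ℕ} [NeZero N] (n₁ n₂ : ℤ)
    (χ : DirichletCharacter ℂ N) : ℂ :=
  ∑ a : (ZMod N)ˣ,
    χ (a : ZMod N) * kloostermanSum N (n₁ : ZMod N) (a : ZMod N)
      * kloostermanSum N (n₂ : ZMod N) (a : ZMod N)

/-! Opening both Kloosterman sums gives a double sum over units `d`, `d'` whose inner sum over `a`
is a Ramanujan sum if `χ` is principal and a Gauss sum otherwise. In the first case everything is
explicit. In the second, `d' = d * t` turns the sum over `d` into another Gauss sum, so K = τ(χ)²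
χ⁻¹(n₂) T with T = ∑ χ(t) χ⁻¹(1+t) χ⁻¹(l+t), l = n₁/n₂. Since |τ(χ)|² = N, it suffices that |T| ≤
2√N.

For l = 1, T is a Jacobi sum up to sign. Otherwise this is Weil's bound. The L-function attached to
T is a polynomial of degree at most 2 (`lCoeff_evalChar_eq_zero`), so by Newton's identities the
analogous sums over extensions of degree k are, up to sign, α^k + β^k. Hence a bound O_p(p^m) in
every degree 2m already forces |α|, |β| ≤ √p.

Such a bound comes from elementary means over a field of Q² elements. Grouping by u = t/((1+t)(l+t))
leaves χ(u) times the quadratic character of a discriminant; substituting u = w v^d with χ^d = 1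
removes χ; Stepanov's method (`stepanov_ne_zero`, `card_filter_pow_eq_one_le`) bounds the remaining
quadratic character sum. -/

open Polynomial

/-! ### Stepanov's method over a field with Q² elements. -/

theorem eq_zero_of_sq_eq_squarefree_mul_sq {F : Type*} [Field F] {f r s : F[X]}
    (hf : Squarefree f) (hdeg : f.natDegree ≠ 0) (h : r ^ 2 = f * s ^ 2) : r = 0 ∧ s = 0 := by
  have hs : s = 0 := by
    by_contra hs
    have hdvd : s ^ 2 ∣ r ^ 2 := ⟨f, by rw [h, mul_comm]⟩
    obtain ⟨t, rfl⟩ := (IsIntegrallyClosed.pow_dvd_pow_iff (by lia)).mp hdvd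
    have ht : t * t = f := by
      have : s ^ 2 * (t * t) = s ^ 2 * f := by linear_combination h
      exact mul_left_cancel₀ (pow_ne_zero 2 hs) this
    have hu : IsUnit t := hf t (ht ▸ dvd_rfl)
    exact hdeg (natDegree_eq_zero_of_isUnit (ht ▸ hu.mul hu))
  subst hs
  exact ⟨by simpa using h, rfl⟩

theorem X_pow_dvd_pow_sub_C {F : Type*} [Field F] {p : ℕ} [Fact p.Prime] [CharP F p] (k : ℕ)
    (f : F[X]) : X ^ p ^ k ∣ f ^ p ^ k - C (f.coeff 0 ^ p ^ k) := by
  rw [C_pow, ← sub_pow_char_pow]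
  exact pow_dvd_pow_of_dvd (X_dvd_iff.mpr (by simp)) _

/-- Multiplying by the conjugate `r - s * f ^ h` gives r² - f^(Q+1) s² with Q = p^k, and f^Q ≡
f(0)^Q modulo X^Q. So X^Q divides r² - c f s², whose degree is below Q; it vanishes, which a
nonconstant squarefree `c f` allows only for r = s = 0. -/
theorem eq_zero_of_X_pow_dvd_add_mul_pow {F : Type*} [Field F] {p : ℕ} [Fact p.Prime] [CharP F p]
    {k h a d : ℕ} (hh : 2 * h = p ^ k + 1) (had : a + d + 2 ≤ h) {f r s : F[X]}
    (hf : Squarefree f) (hf0 : f.coeff 0 ≠ 0) (hdeg : f.natDegree = 2 * d) (hd : d ≠ 0)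
    (hr : r.natDegree ≤ a) (hs : s.natDegree ≤ a) (hX : X ^ p ^ k ∣ r + s * f ^ h) :
    r = 0 ∧ s = 0 := by
  set c := f.coeff 0 ^ p ^ k with hc
  have hc0 : c ≠ 0 := pow_ne_zero _ hf0
  have h1 : X ^ p ^ k ∣ r ^ 2 - C c * f * s ^ 2 := by
    have e : r ^ 2 - C c * f * s ^ 2 =
        (r + s * f ^ h) * (r - s * f ^ h) + f * s ^ 2 * (f ^ p ^ k - C c) := by
      have : f ^ h * f ^ h = f * f ^ p ^ k := by
        rw [← pow_add, ← pow_succ', ← hh, two_mul]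
      linear_combination s ^ 2 * this
    rw [e]
    exact dvd_add (hX.mul_right _) ((X_pow_dvd_pow_sub_C k f).mul_left _)
  have h2 : r ^ 2 - C c * f * s ^ 2 = 0 := by
    apply eq_zero_of_dvd_of_natDegree_lt h1
    rw [natDegree_X_pow]
    have e1 : (r ^ 2).natDegree ≤ 2 * a := (natDegree_pow_le).trans (by lia)
    have e2 : (C c * f * s ^ 2).natDegree ≤ 2 * d + 2 * a := by
      refine natDegree_mul_le.trans (add_le_add ((natDegree_C_mul_le _ _).trans hdeg.le) ?_)
      exact natDegree_pow_le.trans (by lia)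
    have := natDegree_sub_le (r ^ 2) (C c * f * s ^ 2)
    have := max_le (e1.trans (by lia : 2 * a ≤ 2 * d + 2 * a)) e2
    lia
  have hcu : IsUnit (C c) := isUnit_C.mpr (isUnit_iff_ne_zero.mpr hc0)
  refine eq_zero_of_sq_eq_squarefree_mul_sq (f := C c * f) ?_ ?_ (sub_eq_zero.mp h2)
  · intro x hx
    exact hf x ((hcu.dvd_mul_left).mp hx)
  · rw [natDegree_C_mul hc0, hdeg]; lia

/-- A Stepanov auxiliary polynomial does not vanish identically. -/
theorem stepanov_ne_zero {F : Type*} [Field F] {p : ℕ} [Fact p.Prime] [CharP F p]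
    {k h a d : ℕ} (hh : 2 * h = p ^ k + 1) (had : a + d + 2 ≤ h) {f : F[X]}
    (hf : Squarefree f) (hf0 : f.coeff 0 ≠ 0) (hdeg : f.natDegree = 2 * d) (hd : d ≠ 0) :
    ∀ {J : ℕ} (r s : Fin J → F[X]), (∀ j, (r j).natDegree ≤ a) → (∀ j, (s j).natDegree ≤ a) →
      ∑ j : Fin J, X ^ (p ^ k * (j : ℕ)) * (r j + s j * f ^ h) = 0 → r = 0 ∧ s = 0 := by
  intro J
  induction J with
  | zero => intro r s _ _ _; exact ⟨Subsingleton.elim _ _, Subsingleton.elim _ _⟩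
  | succ J ih =>
    intro r s hr hs h0
    rw [Fin.sum_univ_succ] at h0
    have e : ∑ j : Fin J, X ^ (p ^ k * ((j.succ : Fin (J + 1)) : ℕ)) *
        (r j.succ + s j.succ * f ^ h) =
        X ^ p ^ k * ∑ j : Fin J, X ^ (p ^ k * (j : ℕ)) * (r j.succ + s j.succ * f ^ h) := by
      rw [Finset.mul_sum]
      refine Finset.sum_congr rfl fun j _ => ?_
      rw [Fin.val_succ, Nat.mul_succ, pow_add]; ring
    rw [e] at h0
    simp only [Fin.val_zero, mul_zero, pow_zero, one_mul] at h0
    -- Modulo X^Q only the block j = 0 survives; once it is zero, X^Q can be cancelled and the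
    -- induction continues.
    have hX : X ^ p ^ k ∣ r 0 + s 0 * f ^ h := by
      rw [eq_neg_of_add_eq_zero_left h0]
      exact (dvd_mul_right _ _).neg_right
    obtain ⟨r0, s0⟩ := eq_zero_of_X_pow_dvd_add_mul_pow hh had hf hf0 hdeg hd (hr 0) (hs 0) hX
    rw [r0, s0, zero_mul, add_zero, zero_add] at h0
    obtain ⟨hr', hs'⟩ := ih (fun j => r j.succ) (fun j => s j.succ) (fun j => hr _)
      (fun j => hs _) ((mul_eq_zero.mp h0).resolve_left (pow_ne_zero _ X_ne_zero))
    constructor <;> funext j <;> refine Fin.cases ?_ (fun i => ?_) j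
    exacts [r0, congrFun hr' i, s0, congrFun hs' i]

theorem mem_degreeLT_succ_iff {F : Type*} [Field F] {a : ℕ} {f : F[X]} :
    f ∈ degreeLT F (a + 1) ↔ f.natDegree ≤ a := by
  rw [mem_degreeLT, Polynomial.natDegree_le_iff_coeff_eq_zero, degree_lt_iff_coeff_zero]
  exact ⟨fun h n hn => h n hn, fun h n hn => h n hn⟩

/-- Linear algebra: a nontrivial relation `∑ (ρⱼ(X^Q) + g σⱼ(X^Q)) X^j = 0`. -/
theorem exists_expand_relation {F : Type*} [Field F] (Q a J D : ℕ) (g : F[X])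
    (hg : g.natDegree ≤ D) (hJ : Q * a + J + D + 1 < 2 * (a + 1) * J) :
    ∃ ρ σ : Fin J → F[X], (∀ j, (ρ j).natDegree ≤ a) ∧ (∀ j, (σ j).natDegree ≤ a) ∧
      ¬ (ρ = 0 ∧ σ = 0) ∧ ∑ j : Fin J, X ^ (j : ℕ) * (expand F Q (ρ j) + g * expand F Q (σ j)) = 0 := by
  let T : (Fin J → (degreeLT F (a + 1) × degreeLT F (a + 1))) →ₗ[F] F[X] :=
    { toFun := fun v => ∑ j : Fin J, X ^ (j : ℕ) * (expand F Q (v j).1 + g * expand F Q (v j).2)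
      map_add' := fun v w => by
        rw [← Finset.sum_add_distrib]
        refine Finset.sum_congr rfl fun j _ => ?_
        simp only [Pi.add_apply, Prod.fst_add, Prod.snd_add, Submodule.coe_add, map_add]
        ring
      map_smul' := fun c v => by
        rw [RingHom.id_apply, Finset.smul_sum]
        refine Finset.sum_congr rfl fun j _ => ?_
        simp only [Pi.smul_apply, Prod.smul_fst, Prod.smul_snd, Submodule.coe_smul, map_smul,
          mul_smul_comm, smul_add, mul_add] }
  have hT : ∀ v, T v ∈ degreeLT F (Q * a + J + D + 1) := by
    intro v
    change ∑ j : Fin J, X ^ (j : ℕ) * (expand F Q (v j).1 + g * expand F Q (v j).2) ∈ _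
    refine Submodule.sum_mem _ fun j _ => mem_degreeLT_succ_iff.mpr ?_
    have h1 := mem_degreeLT_succ_iff.mp (v j).1.2
    have h2 := mem_degreeLT_succ_iff.mp (v j).2.2
    have hj := j.2
    refine natDegree_mul_le.trans ?_
    rw [natDegree_X_pow]
    have e1 : (expand F Q ((v j).1 : F[X])).natDegree ≤ Q * a + D := by
      rw [natDegree_expand, mul_comm]; nlinarith
    have e2 : (g * expand F Q ((v j).2 : F[X])).natDegree ≤ Q * a + D := by
      refine natDegree_mul_le.trans ?_
      rw [natDegree_expand, mul_comm]; nlinarith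
    have := (natDegree_add_le _ _).trans (max_le e1 e2)
    lia
  have : Module.Finite F (degreeLT F (a + 1)) := Module.Finite.equiv (degreeLTEquiv F (a + 1)).symm
  have : Module.Finite F (degreeLT F (Q * a + J + D + 1)) :=
    Module.Finite.equiv (degreeLTEquiv F _).symm
  have hfin : ∀ n, Module.finrank F (degreeLT F n) = n := fun n => by
    rw [(degreeLTEquiv F n).finrank_eq, Module.finrank_fin_fun]
  have hker : (T.codRestrict _ hT).ker ≠ ⊥ := by
    apply LinearMap.ker_ne_bot_of_finrank_lt
    rw [hfin, Module.finrank_pi_fintype]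
    simp only [Module.finrank_prod, hfin, Finset.sum_const, Finset.card_univ, Fintype.card_fin,
      smul_eq_mul]
    nlinarith
  obtain ⟨v, hv, hv0⟩ := Submodule.exists_mem_ne_zero_of_ne_bot hker
  refine ⟨fun j => (v j).1, fun j => (v j).2, fun j => mem_degreeLT_succ_iff.mp (v j).1.2,
    fun j => mem_degreeLT_succ_iff.mp (v j).2.2, fun h => hv0 ?_, ?_⟩
  · funext j
    exact Prod.ext (Subtype.ext (congrFun h.1 j)) (Subtype.ext (congrFun h.2 j))
  · exact congrArg Subtype.val (LinearMap.mem_ker.mp hv)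

/-- Over a field with `Q²` elements, a squarefree polynomial of degree `2d` with nonzero constant
coefficient takes nonzero square values at most `Q²/2 + O(dQ)` times. -/
theorem card_filter_pow_eq_one_le {F : Type*} [Field F] [Fintype F] [DecidableEq F] {p : ℕ}
    [Fact p.Prime] [CharP F p] {k h d : ℕ} (hcard : Fintype.card F = (p ^ k) ^ 2)
    (hh : 2 * h = p ^ k + 1) (hhd : 2 * d + 5 ≤ h) {f : F[X]}
    (hf : Squarefree f) (hf0 : f.coeff 0 ≠ 0) (hdeg : f.natDegree = 2 * d) (hd : d ≠ 0) :
    (Finset.univ.filter fun x : F => f.eval x ^ (Fintype.card F / 2) = 1).card ≤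
      2 * h ^ 2 + 6 * d * h := by
  set Q := p ^ k with hQ
  obtain ⟨a, ha⟩ : ∃ a, h = a + d + 2 := ⟨h - d - 2, by lia⟩
  have hQ' : Q = 2 * a + 2 * d + 3 := by lia
  have hgdeg : (f ^ h).natDegree ≤ 2 * d * h := natDegree_pow_le.trans (by rw [hdeg, mul_comm])
  -- About Q/2 blocks nearly balance unknowns and equations; the extra `2 * d` give a surplus of
  -- unknowns as soon as a ≥ d + 3, which is `hhd`.
  obtain ⟨ρ, σ, hρ, hσ, hne, hrel⟩ := exists_expand_relation Q a (h + 2 * d + 1) (2 * d * h)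
    (f ^ h) hgdeg (by
      rw [hQ', ha]
      obtain ⟨b, rfl⟩ : ∃ b, a = b + d + 3 := ⟨a - d - 3, by lia⟩
      ring_nf
      nlinarith)
  set φ := iterateFrobenius F p k with hφ
  have hφx : ∀ x, φ x = x ^ Q := fun x => iterateFrobenius_def p k x
  -- `H` is the Q-th power of the zero relation, reduced by x^(Q²) = x and by f(x)^(hQ) = f(x)^h at
  -- the points counted. It therefore vanishes there, though not identically. Its degree is about
  -- Q²/2, so simple zeros suffice and no derivatives are needed.
  set H : F[X] := ∑ j : Fin (h + 2 * d + 1),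
    X ^ (Q * (j : ℕ)) * ((ρ j).map φ + (σ j).map φ * f ^ h) with hH
  have hmd : ∀ g : F[X], (g.map φ).natDegree = g.natDegree := fun g => natDegree_map φ
  have hH0 : H ≠ 0 := fun h0 => by
    have := stepanov_ne_zero (a := a) hh (by lia) hf hf0 hdeg hd
      (fun j => (ρ j).map φ) (fun j => (σ j).map φ)
      (fun j => (hmd _).trans_le (hρ j)) (fun j => (hmd _).trans_le (hσ j)) h0
    exact hne ⟨funext fun j => (Polynomial.map_eq_zero φ).mp (congrFun this.1 j),
      funext fun j => (Polynomial.map_eq_zero φ).mp (congrFun this.2 j)⟩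
  have hq : ∀ x : F, (x ^ Q) ^ Q = x := fun x => by
    rw [← pow_mul, ← sq, ← hcard, FiniteField.pow_card]
  have hmap : ∀ (g : F[X]) (x : F), (g.map φ).eval x = (g.eval (x ^ Q)) ^ Q := fun g x => by
    rw [← hφx (g.eval _), ← eval_map_apply, hφx, hq]
  have hroot : ∀ x : F, f.eval x ^ (Fintype.card F / 2) = 1 → H.eval x = 0 := by
    intro x hx
    -- With q = Q² and 2h = Q + 1, hQ = (q - 1)/2 + h.
    have hexp : h * Q = Fintype.card F / 2 + h := by
      have : Q ^ 2 / 2 + h = h * Q := by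
        obtain ⟨b, rfl⟩ : ∃ b, h = b + 1 := ⟨h - 1, by lia⟩
        have : Q = 2 * b + 1 := by lia
        rw [this]
        have : (2 * b + 1) ^ 2 = 2 * (2 * b ^ 2 + 2 * b) + 1 := by ring
        rw [this]
        have : (2 * (2 * b ^ 2 + 2 * b) + 1) / 2 = 2 * b ^ 2 + 2 * b := by lia
        rw [this]; ring
      rw [hcard, this]
    have hfx : (f.eval x ^ h) ^ Q = f.eval x ^ h := by
      rw [← pow_mul, hexp, pow_add, hx, one_mul]
    have hK := congrArg (fun g => φ (g.eval x)) hrel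
    simp only [eval_finsetSum, eval_mul, eval_add, eval_pow, eval_X, expand_eval, eval_zero,
      map_zero] at hK
    rw [map_sum] at hK
    simp only [map_mul, map_add] at hK
    simp only [hφx, hfx] at hK
    rw [hH]
    simp only [eval_finsetSum, eval_mul, eval_add, eval_pow, eval_X, hmap]
    rw [← hK]
    refine Finset.sum_congr rfl fun j _ => ?_
    rw [pow_mul, ← pow_mul x, ← pow_mul x, mul_comm Q]; ring
  have hsub : (Finset.univ.filter fun x : F => f.eval x ^ (Fintype.card F / 2) = 1) ⊆
      H.roots.toFinset := by
    intro x hx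
    rw [Multiset.mem_toFinset, mem_roots hH0]
    exact hroot x (Finset.mem_filter.mp hx).2
  have hHd : H.natDegree ≤ Q * (h + 2 * d) + (a + 2 * d * h) := by
    rw [hH]
    refine natDegree_sum_le_of_forall_le _ _ fun j _ => ?_
    refine natDegree_mul_le.trans (add_le_add ?_ ?_)
    · rw [natDegree_X_pow]; exact Nat.mul_le_mul_left _ (by have := j.2; lia)
    · refine (natDegree_add_le _ _).trans (max_le ?_ ?_)
      · rw [hmd]; exact (hρ j).trans (by lia)
      · refine natDegree_mul_le.trans (add_le_add ?_ hgdeg)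
        rw [hmd]; exact hσ j
  calc _ ≤ H.roots.toFinset.card := Finset.card_le_card hsub
    _ ≤ _ := Multiset.toFinset_card_le _
    _ ≤ _ := card_roots' H
    _ ≤ _ := hHd
    _ ≤ _ := by
      have : Q + 1 = 2 * h := by lia
      nlinarith

/-! ### Character sums over a field with Q² elements. -/

theorem sum_eq_zero_add_sum_units {F M : Type*} [Field F] [Fintype F] [DecidableEq F]
    [AddCommMonoid M] (g : F → M) : ∑ x, g x = g 0 + ∑ u : Fˣ, g u := by
  rw [Fintype.sum_eq_add_sum_subtype_ne g 0]
  congr 1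
  exact (Fintype.sum_equiv unitsEquivNeZero _ _ fun _ => rfl).symm

theorem norm_mulChar_units {F : Type*} [Field F] [Finite F] (χ : MulChar F ℂ) (u : Fˣ) :
    ‖χ u‖ = 1 := by
  cases nonempty_fintype Fˣ
  exact Complex.norm_eq_one_of_mem_rootsOfUnity (χ.apply_mem_rootsOfUnity u)

theorem norm_mulChar_le_one {F : Type*} [Field F] [Finite F] (χ : MulChar F ℂ) (x : F) :
    ‖χ x‖ ≤ 1 := by
  by_cases hx : x = 0
  · rw [hx, MulChar.map_zero, norm_zero]; exact zero_le_one
  · exact (norm_mulChar_units χ (Units.mk0 x hx)).le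

theorem card_filter_quadraticChar_eq_one_le {F : Type*} [Field F] [Fintype F] [DecidableEq F]
    {p : ℕ} [Fact p.Prime] [CharP F p] {k h d : ℕ} (hcard : Fintype.card F = (p ^ k) ^ 2)
    (hF : ringChar F ≠ 2) (hh : 2 * h = p ^ k + 1) (hhd : 2 * d + 5 ≤ h) {f : F[X]}
    (hf : Squarefree f) (hf0 : f.coeff 0 ≠ 0) (hdeg : f.natDegree = 2 * d) (hd : d ≠ 0) :
    (Finset.univ.filter fun x : F => quadraticChar F (f.eval x) = 1).card ≤
      2 * h ^ 2 + 6 * d * h := by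
  refine le_trans (Finset.card_le_card fun x hx => ?_)
    (card_filter_pow_eq_one_le hcard hh hhd hf hf0 hdeg hd)
  rw [Finset.mem_filter] at hx ⊢
  refine ⟨hx.1, ?_⟩
  rw [← quadraticChar_eq_pow_of_char_ne_two' hF, hx.2, Int.cast_one]

theorem abs_sum_quadraticChar_le {F : Type*} [Field F] [Fintype F] [DecidableEq F]
    {p : ℕ} [Fact p.Prime] [CharP F p] {k d : ℕ} (hcard : Fintype.card F = (p ^ k) ^ 2)
    (hp : p ≠ 2) {f : F[X]}
    (hf : Squarefree f) (hf0 : f.coeff 0 ≠ 0) (hdeg : f.natDegree = 2 * d) (hd : d ≠ 0) :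
    |∑ x, quadraticChar F (f.eval x)| ≤ (14 * d + 20) * (p : ℤ) ^ k := by
  have hF : ringChar F ≠ 2 := by rwa [← CharP.eq F (‹CharP F p›) (ringChar.charP F)]
  have hodd : Odd (p ^ k) := ((Fact.out : p.Prime).odd_of_ne_two hp).pow
  obtain ⟨h, hh⟩ : ∃ h, 2 * h = p ^ k + 1 := by
    obtain ⟨m, hm⟩ := hodd
    exact ⟨m + 1, by lia⟩
  have hpk : (p : ℤ) ^ k = 2 * h - 1 := by
    have : ((p ^ k : ℕ) : ℤ) = 2 * h - 1 := by lia
    exact_mod_cast this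
  have hh1 : 1 ≤ h := by have := hodd.pos; lia
  have hcardZ : (Fintype.card F : ℤ) = (2 * h - 1) ^ 2 := by
    rw [hcard]; push_cast; rw [hpk]
  by_cases hhd : 2 * d + 5 ≤ h
  -- Applied to `C c * f` with `c` a nonsquare, the same upper bound counts the values of character
  -- -1. The two counts and the few zeros add up to q, so two upper bounds control the difference.
  · obtain ⟨c, hc⟩ := FiniteField.exists_nonsquare hF
    have hc0 : c ≠ 0 := fun h => hc (h ▸ IsSquare.zero)
    have hcη : quadraticChar F c = -1 := quadraticChar_neg_one_iff_not_isSquare.mpr hc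
    have h1 := card_filter_quadraticChar_eq_one_le hcard hF hh hhd hf hf0 hdeg hd
    have h2 := card_filter_quadraticChar_eq_one_le (f := C c * f) hcard hF hh hhd
      (fun x hx => hf x (((isUnit_C.mpr hc0.isUnit).dvd_mul_left).mp hx))
      (by simpa using ⟨hc0, hf0⟩) (by rw [natDegree_C_mul hc0, hdeg]) hd
    have h3 : (Finset.univ.filter fun x : F => f.eval x = 0).card ≤ 2 * d := by
      have hfne : f ≠ 0 := fun h => hf0 (by simp [h])
      calc _ ≤ f.roots.toFinset.card := Finset.card_le_card fun x hx => by
            rw [Multiset.mem_toFinset, mem_roots hfne]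
            exact (Finset.mem_filter.mp hx).2
        _ ≤ _ := Multiset.toFinset_card_le _
        _ ≤ _ := card_roots' f
        _ = _ := hdeg
    simp only [eval_mul, eval_C, map_mul, hcη, neg_one_mul] at h2
    have key : ∀ x : F, quadraticChar F (f.eval x) =
          (if quadraticChar F (f.eval x) = 1 then 1 else 0) -
            (if - quadraticChar F (f.eval x) = 1 then 1 else 0) ∧
        (1 : ℤ) = (if quadraticChar F (f.eval x) = 1 then 1 else 0) +
            (if - quadraticChar F (f.eval x) = 1 then 1 else 0) +
            (if f.eval x = 0 then 1 else 0) := by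
      intro x
      by_cases hx : f.eval x = 0
      · simp [hx]
      · rcases quadraticChar_dichotomy hx with h | h <;> simp [h, hx]
    have e1 : ∑ x, quadraticChar F (f.eval x) =
        ((Finset.univ.filter fun x : F => quadraticChar F (f.eval x) = 1).card : ℤ) -
        (Finset.univ.filter fun x : F => - quadraticChar F (f.eval x) = 1).card := by
      rw [Finset.sum_congr rfl fun x _ => (key x).1, Finset.sum_sub_distrib]
      simp only [Finset.sum_boole]
    have e2 : (Fintype.card F : ℤ) =
        ((Finset.univ.filter fun x : F => quadraticChar F (f.eval x) = 1).card : ℤ) +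
        (Finset.univ.filter fun x : F => - quadraticChar F (f.eval x) = 1).card +
        (Finset.univ.filter fun x : F => f.eval x = 0).card := by
      have : (Fintype.card F : ℤ) = ∑ x : F, (1 : ℤ) := by simp
      rw [this, Finset.sum_congr rfl fun x _ => (key x).2, Finset.sum_add_distrib,
        Finset.sum_add_distrib]
      simp only [Finset.sum_boole]
    zify at h1 h2 h3
    have hdh : (0 : ℤ) ≤ d * h := by positivity
    have hdh' : (0 : ℤ) ≤ d * (h - 1) := mul_nonneg (by positivity) (by lia)
    rw [e1, hpk, abs_le]
    constructor <;> nlinarith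
  -- Here Q ≤ 4d + 7, so the trivial bound Q² is enough.
  · have hle : |∑ x, quadraticChar F (f.eval x)| ≤ (2 * h - 1) ^ 2 := by
      refine (Finset.abs_sum_le_sum_abs _ _).trans ?_
      rw [← hcardZ]
      calc _ ≤ ∑ _x : F, (1 : ℤ) := Finset.sum_le_sum fun x _ => by
            by_cases hx : f.eval x = 0
            · simp [hx]
            · rcases quadraticChar_dichotomy hx with h | h <;> simp [h]
        _ = _ := by simp
    rw [hpk]
    refine hle.trans ?_
    have : (2 * h - 1 : ℤ) ≤ 14 * d + 20 := by lia
    rw [sq]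
    exact mul_le_mul_of_nonneg_right this (by lia)

/-- With y = w X^d, the derivative is a constant times X^(d-1) (2ay + b). The polynomial is 1 at 0,
and (2ay + b)² - 4a f = b² - 4a is a nonzero constant, so both factors are coprime to it. -/
theorem squarefree_quadratic_comp_pow {F : Type*} [Field F] {a b w : F} {d : ℕ}
    (hw : w ≠ 0) (hd : (d : F) ≠ 0) (hdisc : b ^ 2 - 4 * a ≠ 0) :
    Squarefree (C a * (C w * X ^ d) ^ 2 + C b * (C w * X ^ d) + 1 : F[X]) := by
  apply Separable.squarefree
  obtain ⟨e, rfl⟩ : ∃ e, d = e + 1 := ⟨d - 1, by have : d ≠ 0 := fun h => hd (by simp [h]); lia⟩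
  set f : F[X] := C a * (C w * X ^ (e + 1)) ^ 2 + C b * (C w * X ^ (e + 1)) + 1 with hf
  have hder : derivative f =
      C (((e + 1 : ℕ) : F) * w) * (X ^ e * (C (2 * a * w) * X ^ (e + 1) + C b)) := by
    rw [hf]
    simp only [derivative_add, derivative_mul, derivative_pow, derivative_C, derivative_X,
      derivative_one, C_mul]
    simp only [Nat.add_sub_cancel, map_ofNat, map_natCast]
    push_cast
    ring
  rw [Separable, hder]
  refine IsCoprime.mul_right ?_ (IsCoprime.mul_right (IsCoprime.pow_right ?_) ?_)
  · obtain ⟨u, hu⟩ := isUnit_C.mpr (mul_ne_zero hd hw).isUnit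
    exact hu ▸ (isCoprime_one_right.of_isCoprime_of_dvd_right u.isUnit.dvd)
  · refine ⟨1, -(C a * C w ^ 2 * X ^ (2 * e + 1) + C b * C w * X ^ e), ?_⟩
    rw [hf]; ring
  · refine ⟨C (-(b ^ 2 - 4 * a)⁻¹) * (4 * C a),
      C ((b ^ 2 - 4 * a)⁻¹) * (C (2 * a * w) * X ^ (e + 1) + C b), ?_⟩
    have : C ((b ^ 2 - 4 * a)⁻¹) * (C b ^ 2 - 4 * C a) = (1 : F[X]) := by
      have h4 : (4 : F[X]) = C 4 := (map_ofNat C 4).symm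
      rw [h4, ← C_pow, ← C_mul, ← C_sub, ← C_mul, inv_mul_cancel₀ hdisc, C_1]
    rw [← this, hf]
    simp only [C_mul, C_neg, map_ofNat]
    ring

/-- Replacing u by w v^d leaves χ(w) unchanged in v, so averaging over `v` and then `w` reduces to
sums of the quadratic character at a squarefree polynomial in `v` of degree 2d. -/
theorem norm_sum_mulChar_mul_quadraticChar_le {F : Type*} [Field F] [Fintype F] [DecidableEq F]
    {p : ℕ} [Fact p.Prime] [CharP F p] {k d : ℕ} (hcard : Fintype.card F = (p ^ k) ^ 2)
    (hp : p ≠ 2) (χ : MulChar F ℂ) (hχ : χ ^ d = 1) (hd : (d : F) ≠ 0) {a b : F} (ha : a ≠ 0)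
    (hdisc : b ^ 2 - 4 * a ≠ 0) :
    ‖∑ u, χ u * (quadraticChar F (a * u ^ 2 + b * u + 1) : ℂ)‖ ≤ (14 * d + 21) * (p : ℝ) ^ k := by
  have hd0 : d ≠ 0 := fun h => hd (by simp [h])
  have hp1 : (1 : ℝ) ≤ (p : ℝ) ^ k :=
    one_le_pow₀ (by exact_mod_cast (Fact.out : p.Prime).one_lt.le)
  set g : F → ℂ := fun u => (quadraticChar F (a * u ^ 2 + b * u + 1) : ℂ) with hg
  have hinner : ∀ w : Fˣ, ‖∑ v : Fˣ, g (w * v ^ d)‖ ≤ (14 * d + 21) * (p : ℝ) ^ k := by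
    intro w
    set f : F[X] := C a * (C (w : F) * X ^ d) ^ 2 + C b * (C (w : F) * X ^ d) + 1 with hf
    have hsq : Squarefree f := squarefree_quadratic_comp_pow w.ne_zero hd hdisc
    have hf0 : f.coeff 0 ≠ 0 := by
      rw [coeff_zero_eq_eval_zero, hf]
      simp [hd0]
    have hdeg : f.natDegree = 2 * d := by
      have : f = C (a * w ^ 2) * X ^ (2 * d) + C (b * w) * X ^ d + C 1 := by
        rw [hf]; simp only [C_mul, C_pow, C_1]; ring
      rw [this]
      compute_degree!
      · simp [hd0, ha]
      all_goals lia
    have h1 := abs_sum_quadraticChar_le hcard hp hsq hf0 hdeg hd0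
    -- The point 0 contributes 1 because f(0) = 1; removing it turns 20 into 21.
    have h2 : (∑ x, quadraticChar F (f.eval x) : ℤ) =
        1 + ∑ v : Fˣ, quadraticChar F (f.eval (v : F)) := by
      rw [sum_eq_zero_add_sum_units]
      congr 1
      rw [hf]; simp [hd0]
    have h3 : ∑ v : Fˣ, g (w * v ^ d) =
        (((∑ x, quadraticChar F (f.eval x)) - 1 : ℤ) : ℂ) := by
      rw [h2]
      push_cast
      rw [add_sub_cancel_left]
      refine Finset.sum_congr rfl fun v _ => ?_
      simp [hg, hf]
    rw [h3, Complex.norm_intCast]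
    have h4 : |(((∑ x, quadraticChar F (f.eval x)) - 1 : ℤ) : ℝ)| ≤
        |((∑ x, quadraticChar F (f.eval x) : ℤ) : ℝ)| + 1 := by
      push_cast
      simpa using abs_sub (∑ x, (quadraticChar F (f.eval x) : ℝ)) 1
    have h5 : |((∑ x, quadraticChar F (f.eval x) : ℤ) : ℝ)| ≤ (14 * d + 20) * (p : ℝ) ^ k := by
      exact_mod_cast h1
    linarith
  have hS : ∑ u, χ u * g u = ∑ u : Fˣ, χ u * g u := by
    rw [sum_eq_zero_add_sum_units, MulChar.map_zero, zero_mul, zero_add]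
  have hpow : ∀ v : Fˣ, χ ((v : F) ^ d) = 1 := fun v => by
    rw [map_pow, ← MulChar.pow_apply_coe, hχ, MulChar.one_apply_coe]
  have havg : (Fintype.card Fˣ : ℂ) * ∑ u : Fˣ, χ u * g u =
      ∑ w : Fˣ, χ w * ∑ v : Fˣ, g (w * v ^ d) := by
    simp only [Finset.mul_sum]
    rw [Finset.sum_comm, ← Finset.mul_sum, ← nsmul_eq_mul, ← Finset.card_univ, ← Finset.sum_const]
    refine Finset.sum_congr rfl fun v _ => ?_
    rw [← Equiv.sum_comp (Equiv.mulRight (v ^ d))]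
    refine Finset.sum_congr rfl fun w _ => ?_
    simp [hpow]
  rw [hS]
  have hc : (0 : ℝ) < Fintype.card Fˣ := by exact_mod_cast Fintype.card_pos
  refine le_of_mul_le_mul_left ?_ hc
  calc (Fintype.card Fˣ : ℝ) * ‖∑ u : Fˣ, χ u * g u‖
      = ‖(Fintype.card Fˣ : ℂ) * ∑ u : Fˣ, χ u * g u‖ := by rw [norm_mul, Complex.norm_natCast]
    _ = ‖∑ w : Fˣ, χ w * ∑ v : Fˣ, g (w * v ^ d)‖ := by rw [havg]
    _ ≤ ∑ w : Fˣ, ((14 * d + 21) * (p : ℝ) ^ k) := by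
      refine norm_sum_le_of_le _ fun w _ => ?_
      rw [norm_mul]
      have : ‖χ (w : F)‖ ≤ 1 := norm_mulChar_le_one χ w
      calc _ ≤ 1 * _ := mul_le_mul this (hinner w) (norm_nonneg _) zero_le_one
        _ = _ := one_mul _
    _ = _ := by simp

/-- Completing the square: t ↦ 2ut + u(1+l) - 1 carries solutions to square roots of the
discriminant. -/
theorem card_filter_quadratic_fiber {F : Type*} [Field F] [Fintype F] [DecidableEq F]
    (hF : ringChar F ≠ 2) {l u : F} (hu : u ≠ 0) :
    ((Finset.univ.filter fun t : F => u * ((1 + t) * (l + t)) = t).card : ℤ) =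
      quadraticChar F ((1 - l) ^ 2 * u ^ 2 + -2 * (1 + l) * u + 1) + 1 := by
  have h2 : (2 : F) ≠ 0 := Ring.two_ne_zero hF
  rw [← quadraticChar_card_sqrts hF]
  congr 1
  have h2u : 2 * u ≠ 0 := mul_ne_zero h2 hu
  refine Finset.card_equiv ((Equiv.mulLeft₀ (2 * u) h2u).trans
    (Equiv.addRight (u * (1 + l) - 1))) fun t => ?_
  simp only [Finset.mem_filter, Finset.mem_univ, true_and, Set.mem_toFinset, Set.mem_ofPred_eq,
    Equiv.trans_apply, Equiv.mulLeft₀_apply, Equiv.coe_addRight]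
  have h4u : 4 * u ≠ 0 := by
    have : (4 : F) * u = 2 * (2 * u) := by ring
    rw [this]; exact mul_ne_zero h2 h2u
  constructor
  · intro h
    linear_combination (4 * u) * h
  · intro h
    refine mul_left_cancel₀ h4u ?_
    linear_combination h

theorem sum_mulChar_eq_sum_mul_quadraticChar {F : Type*} [Field F] [Fintype F] [DecidableEq F]
    (hF : ringChar F ≠ 2) {l : F} (hl : l ≠ 0) {χ : MulChar F ℂ} (hχ : χ ≠ 1) :
    ∑ t, χ t * χ⁻¹ (1 + t) * χ⁻¹ (l + t) =
      ∑ u, χ u * (quadraticChar F ((1 - l) ^ 2 * u ^ 2 + -2 * (1 + l) * u + 1) : ℂ) := by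
  have h1 : ∀ u : F, χ u * (quadraticChar F ((1 - l) ^ 2 * u ^ 2 + -2 * (1 + l) * u + 1) : ℂ) =
      (∑ t, if u * ((1 + t) * (l + t)) = t then χ u else 0) - χ u := by
    intro u
    by_cases hu : u = 0
    · simp [hu, MulChar.map_zero]
    · have := card_filter_quadratic_fiber hF (l := l) hu
      rw [← Finset.sum_filter, Finset.sum_const, nsmul_eq_mul]
      have h : ((Finset.univ.filter fun t : F => u * ((1 + t) * (l + t)) = t).card : ℂ) =
        (quadraticChar F ((1 - l) ^ 2 * u ^ 2 + -2 * (1 + l) * u + 1) : ℂ) + 1 := by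
        exact_mod_cast congrArg (Int.cast : ℤ → ℂ) this
      rw [h]; ring
  simp only [h1]
  rw [Finset.sum_sub_distrib, MulChar.sum_eq_zero_of_ne_one hχ, sub_zero, Finset.sum_comm]
  refine Finset.sum_congr rfl fun t _ => ?_
  rw [mul_assoc, ← map_mul]
  by_cases hg : (1 + t) * (l + t) = 0
  · rw [hg, MulChar.map_zero, mul_zero]
    -- A pole `t` of t/((1+t)(l+t)) is nonzero, so it lies in no fibre, matching the vanishing left
    -- side.
    have ht : t ≠ 0 := by
      rintro rfl
      simp [hl] at hg
    refine (Finset.sum_eq_zero fun u _ => if_neg ?_).symm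
    rw [mul_zero]; exact ht.symm
  · rw [Finset.sum_eq_single (t * ((1 + t) * (l + t))⁻¹)]
    · rw [if_pos (inv_mul_cancel_right₀ hg t), map_mul χ t, ← MulChar.inv_apply']
    · intro u _ hu
      refine if_neg fun h => hu ?_
      rw [eq_mul_inv_iff_mul_eq₀ hg, h]
    · simp

theorem norm_sum_mulChar_le {F : Type*} [Field F] [Fintype F] [DecidableEq F]
    {p : ℕ} [Fact p.Prime] [CharP F p] {k d : ℕ} (hcard : Fintype.card F = (p ^ k) ^ 2)
    (hp : p ≠ 2) {χ : MulChar F ℂ} (hχ : χ ≠ 1) (hχd : χ ^ d = 1) (hd : (d : F) ≠ 0) {l : F}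
    (hl : l ≠ 0) (hl1 : l ≠ 1) :
    ‖∑ t, χ t * χ⁻¹ (1 + t) * χ⁻¹ (l + t)‖ ≤ (14 * d + 21) * (p : ℝ) ^ k := by
  have hF : ringChar F ≠ 2 := by rwa [← CharP.eq F (‹CharP F p›) (ringChar.charP F)]
  rw [sum_mulChar_eq_sum_mul_quadraticChar hF hl hχ]
  refine norm_sum_mulChar_mul_quadraticChar_le hcard hp χ hχd hd
    (pow_ne_zero 2 (sub_ne_zero.mpr hl1.symm)) ?_
  have : (-2 * (1 + l)) ^ 2 - 4 * (1 - l) ^ 2 = 2 ^ 4 * l := by ring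
  rw [this]
  exact mul_ne_zero (pow_ne_zero _ (Ring.two_ne_zero hF)) hl

/-! ### L-function coefficients and their logarithmic derivative. -/

theorem finite_monic_natDegree_eq (F : Type*) [Field F] [Finite F] (n : ℕ) :
    {g : F[X] | g.Monic ∧ g.natDegree = n}.Finite := by
  have : Finite (degreeLT F (n + 1)) := Finite.of_equiv _ (degreeLTEquiv F (n + 1)).symm.toEquiv
  refine Set.Finite.subset (Set.toFinite (degreeLT F (n + 1) : Set F[X])) fun g hg => ?_
  exact mem_degreeLT_succ_iff.mpr hg.2.le

/-- The monic polynomials of degree `n` over a finite field. -/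
noncomputable def monicFinset (F : Type*) [Field F] [Finite F] (n : ℕ) : Finset F[X] :=
  (finite_monic_natDegree_eq F n).toFinset

theorem mem_monicFinset {F : Type*} [Field F] [Finite F] {n : ℕ} {g : F[X]} :
    g ∈ monicFinset F n ↔ g.Monic ∧ g.natDegree = n := by
  simp [monicFinset]

open scoped Classical in
/-- The monic irreducible polynomials of degree at most `n` over a finite field. -/
noncomputable def primeFinset (F : Type*) [Field F] [Finite F] (n : ℕ) : Finset F[X] :=
  ((Finset.range (n + 1)).biUnion (monicFinset F)).filter Irreducible

theorem mem_primeFinset {F : Type*} [Field F] [Finite F] {n : ℕ} {P : F[X]} :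
    P ∈ primeFinset F n ↔ P.Monic ∧ P.natDegree ≤ n ∧ Irreducible P := by
  simp only [primeFinset, Finset.mem_filter, Finset.mem_biUnion, Finset.mem_range, mem_monicFinset]
  constructor
  · rintro ⟨⟨m, hm, h1, h2⟩, h3⟩
    exact ⟨h1, by lia, h3⟩
  · rintro ⟨h1, h2, h3⟩
    exact ⟨⟨P.natDegree, by lia, h1, rfl⟩, h3⟩

open scoped Classical in
theorem natDegree_eq_sum_pow_dvd {F : Type*} [Field F] [Finite F] {n : ℕ} {g : F[X]}
    (hg : g ∈ monicFinset F n) :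
    n = ∑ P ∈ primeFinset F n, ∑ j ∈ Finset.Icc 1 n, if P ^ j ∣ g then P.natDegree else 0 := by
  obtain ⟨hmon, hdeg⟩ := mem_monicFinset.mp hg
  have hg0 : g ≠ 0 := hmon.ne_zero
  set m := UniqueFactorizationMonoid.normalizedFactors g with hm
  have hmem : ∀ q ∈ m, q.Monic ∧ Irreducible q := fun q hq => by
    have hi := UniqueFactorizationMonoid.irreducible_of_normalized_factor q hq
    refine ⟨?_, hi⟩
    rw [← UniqueFactorizationMonoid.normalize_normalized_factor q hq]
    exact monic_normalize hi.ne_zero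
  have hsub : m.toFinset ⊆ primeFinset F n := fun q hq => by
    rw [Multiset.mem_toFinset] at hq
    refine mem_primeFinset.mpr ⟨(hmem q hq).1, ?_, (hmem q hq).2⟩
    rw [← hdeg]
    exact natDegree_le_of_dvd (UniqueFactorizationMonoid.dvd_of_mem_normalizedFactors hq) hg0
  have hsum : n = ∑ P ∈ primeFinset F n, m.count P * P.natDegree := by
    have h1 : m.prod = g := by
      rw [hm, UniqueFactorizationMonoid.prod_normalizedFactors_eq hg0, hmon.normalize_eq_self]
    refine hdeg.symm.trans ?_
    conv_lhs => rw [← h1]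
    rw [natDegree_multiset_prod_of_monic _ fun q hq => (hmem q hq).1,
      Finset.sum_multiset_map_count]
    simp only [smul_eq_mul]
    refine Finset.sum_subset hsub fun q _ hq => ?_
    rw [Multiset.count_eq_zero_of_notMem (by simpa using hq), zero_mul]
  conv_lhs => rw [hsum]
  refine Finset.sum_congr rfl fun P hP => ?_
  obtain ⟨hP1, -, hP3⟩ := mem_primeFinset.mp hP
  have hdvd : ∀ j, P ^ j ∣ g ↔ j ≤ m.count P := fun j => by
    rw [pow_dvd_iff_le_emultiplicity,
      UniqueFactorizationMonoid.emultiplicity_eq_count_normalizedFactors hP3 hg0,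
      hP1.normalize_eq_self, Nat.cast_le]
  have hcn : m.count P ≤ n := by
    have := natDegree_le_of_dvd ((hdvd _).mpr le_rfl) hg0
    rw [natDegree_pow, hdeg] at this
    have := hP3.natDegree_pos
    nlinarith
  simp only [hdvd]
  rw [← Finset.sum_filter, Finset.sum_const, smul_eq_mul]
  congr 1
  have : (Finset.Icc 1 n).filter (fun j => j ≤ m.count P) = Finset.Icc 1 (m.count P) := by
    ext j; simp only [Finset.mem_filter, Finset.mem_Icc]; lia
  rw [this, Nat.card_Icc, Nat.add_sub_cancel]

/-- The `n`-th coefficient of the `L`-function of a completely multiplicative function. -/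
noncomputable def lCoeff {F : Type*} [Field F] [Finite F] (ψ : F[X] →* ℂ) (n : ℕ) : ℂ :=
  ∑ g ∈ monicFinset F n, ψ g

theorem lCoeff_zero {F : Type*} [Field F] [Finite F] (ψ : F[X] →* ℂ) : lCoeff ψ 0 = 1 := by
  have : monicFinset F 0 = {1} := by
    ext g
    rw [mem_monicFinset, Finset.mem_singleton]
    exact ⟨fun h => h.1.natDegree_eq_zero.mp h.2, fun h => h ▸ ⟨monic_one, natDegree_one⟩⟩
  rw [lCoeff, this, Finset.sum_singleton, map_one]

theorem lCoeff_one {F : Type*} [Field F] [Fintype F] (ψ : F[X] →* ℂ) :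
    lCoeff ψ 1 = ∑ x : F, ψ (X - C x) := by
  refine (Finset.sum_bij (fun x _ => X - C x) ?_ ?_ ?_ ?_).symm
  · exact fun x _ => mem_monicFinset.mpr ⟨monic_X_sub_C x, natDegree_X_sub_C x⟩
  · intro x _ y _ h
    exact C_injective (sub_right_injective h)
  · intro g hg
    obtain ⟨h1, h2⟩ := mem_monicFinset.mp hg
    refine ⟨-g.coeff 0, Finset.mem_univ _, ?_⟩
    rw [C_neg, sub_neg_eq_add]
    exact (h1.eq_X_add_C h2).symm
  · exact fun _ _ => rfl

open scoped Classical in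
theorem sum_monicFinset_dvd {F : Type*} [Field F] [Finite F] (ψ : F[X] →* ℂ) {n : ℕ} {R : F[X]}
    (hR : R.Monic) :
    (∑ g ∈ monicFinset F n, if R ∣ g then ψ g else 0) =
      if R.natDegree ≤ n then ψ R * lCoeff ψ (n - R.natDegree) else 0 := by
  rw [← Finset.sum_filter]
  split_ifs with h
  · rw [lCoeff, Finset.mul_sum]
    symm
    refine Finset.sum_bij (fun g _ => R * g) ?_ ?_ ?_ ?_
    · intro g hg
      obtain ⟨h1, h2⟩ := mem_monicFinset.mp hg
      rw [Finset.mem_filter, mem_monicFinset]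
      refine ⟨⟨hR.mul h1, ?_⟩, dvd_mul_right _ _⟩
      rw [hR.natDegree_mul h1, h2]; lia
    · intro a _ b _ hab
      exact mul_left_cancel₀ hR.ne_zero hab
    · intro g hg
      rw [Finset.mem_filter, mem_monicFinset] at hg
      obtain ⟨⟨h1, h2⟩, q, rfl⟩ := hg
      have hq := hR.of_mul_monic_left h1
      refine ⟨q, mem_monicFinset.mpr ⟨hq, ?_⟩, rfl⟩
      rw [hR.natDegree_mul hq] at h2; lia
    · intro g _
      rw [map_mul]
  · rw [Finset.filter_eq_empty_iff.mpr, Finset.sum_empty]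
    intro g hg hdvd
    obtain ⟨h1, h2⟩ := mem_monicFinset.mp hg
    exact h (h2 ▸ natDegree_le_of_dvd hdvd h1.ne_zero)

/-- The sum of `deg P * ψ (P ^ j)` over prime powers `P ^ j` of degree `k`. -/
noncomputable def primePowerSum {F : Type*} [Field F] [Finite F] (ψ : F[X] →* ℂ) (n k : ℕ) : ℂ :=
  ∑ P ∈ primeFinset F n, ∑ j ∈ Finset.Icc 1 n,
    if j * P.natDegree = k then P.natDegree * ψ P ^ j else 0

/-- The logarithmic derivative of the Euler product, coefficient by coefficient: weight each `g` by
its degree, written as the sum of deg P over prime powers P^j dividing `g`, and exchange sums. -/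
theorem nat_mul_lCoeff {F : Type*} [Field F] [Finite F] (ψ : F[X] →* ℂ) (n : ℕ) :
    n * lCoeff ψ n = ∑ k ∈ Finset.Icc 1 n, primePowerSum ψ n k * lCoeff ψ (n - k) := by
  classical
  have h1 : n * lCoeff ψ n = ∑ P ∈ primeFinset F n, ∑ j ∈ Finset.Icc 1 n,
      P.natDegree * ∑ g ∈ monicFinset F n, if P ^ j ∣ g then ψ g else 0 := by
    rw [lCoeff, Finset.mul_sum]
    simp only [Finset.mul_sum]
    have : ∀ g ∈ monicFinset F n, (n : ℂ) * ψ g = ∑ P ∈ primeFinset F n, ∑ j ∈ Finset.Icc 1 n,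
        P.natDegree * if P ^ j ∣ g then ψ g else 0 := by
      intro g hg
      conv_lhs => rw [natDegree_eq_sum_pow_dvd hg]
      push_cast
      rw [Finset.sum_mul]
      refine Finset.sum_congr rfl fun P _ => ?_
      rw [Finset.sum_mul]
      refine Finset.sum_congr rfl fun j _ => ?_
      split_ifs <;> simp
    rw [Finset.sum_congr rfl this, Finset.sum_comm]
    refine Finset.sum_congr rfl fun P _ => ?_
    rw [Finset.sum_comm]
  rw [h1]
  simp only [primePowerSum, Finset.sum_mul]
  symm
  rw [Finset.sum_comm]
  refine Finset.sum_congr rfl fun P hP => ?_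
  rw [Finset.sum_comm]
  refine Finset.sum_congr rfl fun j hj => ?_
  obtain ⟨hP1, -, hP3⟩ := mem_primeFinset.mp hP
  have hpos : 1 ≤ j * P.natDegree :=
    Nat.mul_pos (Finset.mem_Icc.mp hj).1 hP3.natDegree_pos
  rw [sum_monicFinset_dvd ψ (hP1.pow j), natDegree_pow, map_pow]
  simp only [ite_mul, zero_mul]
  rw [Finset.sum_ite_eq]
  simp only [Finset.mem_Icc, hpos, true_and, mul_ite, mul_zero]
  split_ifs <;> ring

theorem card_filter_minpoly_eq {F E : Type*} [Field F] [Finite F] [Field E] [Fintype E]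
    [Algebra F E] [DecidableEq F[X]] {P : F[X]} (hP : P.Monic) (hirr : Irreducible P) :
    (Finset.univ.filter fun x : E => minpoly F x = P).card =
      if P.natDegree ∣ Module.finrank F E then P.natDegree else 0 := by
  split_ifs with h
  · have : Fact (Irreducible P) := ⟨hirr⟩
    have hfr : Module.finrank F (AdjoinRoot P) = P.natDegree := by
      rw [(AdjoinRoot.powerBasis hP.ne_zero).finrank, AdjoinRoot.powerBasis_dim]
    have : Module.Finite F (AdjoinRoot P) := (AdjoinRoot.powerBasis hP.ne_zero).finite
    have : Finite (AdjoinRoot P) := Module.finite_of_finite F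
    have hc := FiniteField.card_algHom_of_finrank_dvd (F := F) (K := AdjoinRoot P) (L := E)
      (by rwa [hfr])
    rw [hfr] at hc
    rw [← hc, ← Nat.card_eq_fintype_card, Nat.card_congr (AdjoinRoot.equiv E F P hP.ne_zero),
      ← Nat.subtype_card (p := fun x => x ∈ P.aroots E)]
    intro x
    rw [Finset.mem_filter, mem_aroots]
    constructor
    · rintro ⟨-, rfl⟩
      exact ⟨hP.ne_zero, minpoly.aeval F x⟩
    · rintro ⟨-, hx⟩
      exact ⟨Finset.mem_univ _, (minpoly.eq_of_irreducible_of_monic hirr hx hP).symm⟩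
  · rw [Finset.card_eq_zero, Finset.filter_eq_empty_iff]
    rintro x - rfl
    exact h (minpoly.degree_dvd (Algebra.IsIntegral.isIntegral x))

/-- Each monic irreducible P with degree dividing [E : F] is the minimal polynomial of exactly deg P
elements of `E`. In particular the truncation `n` is immaterial. -/
theorem primePowerSum_eq_sum {F E : Type*} [Field F] [Finite F] [Field E] [Fintype E]
    [Algebra F E] (ψ : F[X] →* ℂ) {n : ℕ} (hn : Module.finrank F E ≤ n) :
    primePowerSum ψ n (Module.finrank F E) =
      ∑ x : E, ψ (minpoly F x) ^ (Module.finrank F E / (minpoly F x).natDegree) := by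
  classical
  set k := Module.finrank F E with hk
  have hk0 : 0 < k := Module.finrank_pos
  have hint : ∀ x : E, IsIntegral F x := fun x => Algebra.IsIntegral.isIntegral x
  have hmaps : ∀ x ∈ (Finset.univ : Finset E), minpoly F x ∈ primeFinset F n := fun x _ =>
    mem_primeFinset.mpr ⟨minpoly.monic (hint x),
      (Nat.le_of_dvd hk0 (minpoly.degree_dvd (hint x))).trans hn, minpoly.irreducible (hint x)⟩
  rw [← Finset.sum_fiberwise_of_maps_to hmaps, primePowerSum]
  refine Finset.sum_congr rfl fun P hP => ?_
  obtain ⟨hP1, hP2, hP3⟩ := mem_primeFinset.mp hP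
  have hd := hP3.natDegree_pos
  have hconst : ∀ x ∈ Finset.univ.filter (fun x : E => minpoly F x = P),
      ψ (minpoly F x) ^ (k / (minpoly F x).natDegree) = ψ P ^ (k / P.natDegree) := fun x hx => by
    rw [(Finset.mem_filter.mp hx).2]
  rw [Finset.sum_congr rfl hconst, Finset.sum_const, card_filter_minpoly_eq hP1 hP3,
    nsmul_eq_mul, ← hk]
  split_ifs with h
  · obtain ⟨e, he⟩ := h
    rw [he, Nat.mul_div_cancel_left e hd]
    have hiff : ∀ j, j * P.natDegree = P.natDegree * e ↔ e = j := fun j => by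
      rw [mul_comm, Nat.mul_right_inj hd.ne', eq_comm]
    simp only [hiff]
    rw [Finset.sum_ite_eq, if_pos]
    rw [Finset.mem_Icc]
    constructor
    · rcases Nat.eq_zero_or_pos e with h0 | h0
      · rw [he, h0] at hk0; simp at hk0
      · exact h0
    · nlinarith
  · rw [Nat.cast_zero, zero_mul]
    refine Finset.sum_eq_zero fun j _ => if_neg fun hj => h ⟨j, by rw [← hj, mul_comm]⟩

/-! ### From power sums to the size of the reciprocal roots. -/

theorem le_of_forall_pow_le_mul_pow {t r K : ℝ} (hr : 0 < r)
    (h : ∀ m : ℕ, 1 ≤ m → t ^ m ≤ K * r ^ m) : t ≤ r := by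
  by_contra! hlt
  have h1 : 1 < t / r := (one_lt_div hr).mpr hlt
  obtain ⟨n, hn⟩ := pow_unbounded_of_one_lt K h1
  have h2 := h (n + 1) (by lia)
  rw [← div_le_iff₀ (pow_pos hr _), ← div_pow] at h2
  have h3 : (t / r) ^ n ≤ (t / r) ^ (n + 1) := pow_le_pow_right₀ h1.le (by lia)
  linarith

/-- The product (AB)^m is a combination of power sums, so |AB| ≤ r². If |A| > r then |B| ≤ r, and
A^m is O(r^m) after all. -/
theorem norm_le_of_forall_norm_pow_add_pow_le {A B : ℂ} {r K : ℝ} (hr : 0 < r)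
    (h : ∀ m : ℕ, 1 ≤ m → ‖A ^ m + B ^ m‖ ≤ K * r ^ m) : ‖A‖ ≤ r := by
  have hAB : ‖A‖ * ‖B‖ ≤ r ^ 2 := by
    refine le_of_forall_pow_le_mul_pow (K := K ^ 2 + K) (by positivity) fun m hm => ?_
    have h1 := h m hm
    have h2 := h (2 * m) (by lia)
    have e : 2 * (A * B) ^ m = (A ^ m + B ^ m) ^ 2 - (A ^ (2 * m) + B ^ (2 * m)) := by ring
    have h3 : 2 * (‖A‖ * ‖B‖) ^ m = ‖(A ^ m + B ^ m) ^ 2 - (A ^ (2 * m) + B ^ (2 * m))‖ := by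
      rw [← e, norm_mul, norm_pow, norm_mul]; simp
    have h4 := norm_sub_le ((A ^ m + B ^ m) ^ 2) (A ^ (2 * m) + B ^ (2 * m))
    have h5 : ‖(A ^ m + B ^ m) ^ 2‖ ≤ (K * r ^ m) ^ 2 := by
      rw [norm_pow]; exact pow_le_pow_left₀ (norm_nonneg _) h1 2
    have h6 : 0 ≤ (‖A‖ * ‖B‖) ^ m := by positivity
    calc (‖A‖ * ‖B‖) ^ m ≤ 2 * (‖A‖ * ‖B‖) ^ m := by linarith
      _ ≤ (K * r ^ m) ^ 2 + K * r ^ (2 * m) := by rw [h3]; linarith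
      _ = _ := by ring
  by_contra! hlt
  have hB : ‖B‖ ≤ r := by
    by_contra! hB
    nlinarith
  refine absurd (le_of_forall_pow_le_mul_pow (K := K + 1) hr fun m hm => ?_) (not_le.mpr hlt)
  have h1 := h m hm
  have h2 : ‖A ^ m‖ ≤ ‖A ^ m + B ^ m‖ + ‖B ^ m‖ := by
    simpa using norm_sub_le (A ^ m + B ^ m) (B ^ m)
  rw [norm_pow, norm_pow] at h2
  have h3 := pow_le_pow_left₀ (norm_nonneg B) hB m
  linarith

/-- The generating function of `a` is (1 - αT)(1 - βT); these are Newton's identities for it. -/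
theorem eq_neg_pow_add_pow_of_newton {a S : ℕ → ℂ} {α β : ℂ} (h0 : a 0 = 1)
    (h1 : a 1 = -(α + β)) (h2 : a 2 = α * β) (h3 : ∀ n, 3 ≤ n → a n = 0)
    (hN : ∀ n : ℕ, n * a n = ∑ k ∈ Finset.Icc 1 n, S k * a (n - k)) :
    ∀ k, 1 ≤ k → S k = -(α ^ k + β ^ k) := by
  have e1 : S 1 = -(α + β) := by
    have := hN 1
    simp only [Finset.Icc_self, Finset.sum_singleton, Nat.sub_self, h0, h1] at this
    linear_combination -this
  have e2 : S 2 = -(α ^ 2 + β ^ 2) := by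
    have := hN 2
    rw [Finset.sum_Icc_succ_top (by norm_num)] at this
    simp only [Finset.Icc_self, Finset.sum_singleton, Nat.reduceAdd, Nat.sub_self, h0, h1, h2,
      Nat.reduceSub, e1] at this
    push_cast at this
    linear_combination -this
  have e3 : ∀ n, S (n + 3) + S (n + 2) * a 1 + S (n + 1) * a 2 = 0 := by
    intro n
    have := hN (n + 3)
    rw [h3 _ (by lia), mul_zero, Finset.sum_Icc_succ_top (by lia), Finset.sum_Icc_succ_top (by lia),
      Finset.sum_Icc_succ_top (by lia), Finset.sum_eq_zero] at this
    · have i1 : n + 2 + 1 - (n + 2 + 1) = 0 := by lia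
      have i2 : n + 2 + 1 - (n + 1 + 1) = 1 := by lia
      have i3 : n + 2 + 1 - (n + 1) = 2 := by lia
      rw [i1, i2, i3, h0] at this
      linear_combination -this
    · intro k hk
      rw [Finset.mem_Icc] at hk
      rw [h3 _ (by lia), mul_zero]
  have key : ∀ n, S (n + 1) = -(α ^ (n + 1) + β ^ (n + 1)) ∧
      S (n + 2) = -(α ^ (n + 2) + β ^ (n + 2)) := by
    intro n
    induction n with
    | zero => exact ⟨by simpa using e1, e2⟩
    | succ n ih =>
      refine ⟨ih.2, ?_⟩
      have := e3 n
      rw [ih.1, ih.2, h1, h2] at this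
      have e : n + 1 + 2 = n + 3 := by lia
      rw [e]
      linear_combination this
  intro k hk
  obtain ⟨n, rfl⟩ : ∃ n, k = n + 1 := ⟨k - 1, by lia⟩
  exact (key n).1

/-! ### Lifting characters through the norm. -/

/-- Both sides are the characteristic polynomial of `x` evaluated at `a`. -/
theorem eval_minpoly_pow_eq_norm {F E : Type*} [Field F] [Field E] [Algebra F E]
    [Module.Finite F E] (x : E) (a : F) :
    (minpoly F x).eval a ^ (Module.finrank F E / (minpoly F x).natDegree) =
      Algebra.norm F (algebraMap F E a - x) := by
  set y := x - algebraMap F E a with hy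
  have hint : ∀ z : E, IsIntegral F z := fun z => Algebra.IsIntegral.isIntegral z
  have hmin : minpoly F y = (minpoly F x).comp (X + C a) := minpoly.sub_algebraMap x a
  have hdeg : (minpoly F y).natDegree = (minpoly F x).natDegree := by
    rw [hmin, natDegree_comp, natDegree_X_add_C, mul_one]
  have hc0 : (minpoly F y).coeff 0 = (minpoly F x).eval a := by
    rw [coeff_zero_eq_eval_zero, hmin, eval_comp]; simp
  have hfr := IntermediateField.adjoin.finrank (hint y)
  have hmul := Module.finrank_mul_finrank F (IntermediateField.adjoin F {y}) E
  have hpos : 0 < (minpoly F x).natDegree := minpoly.natDegree_pos (hint x)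
  have hdiv : Module.finrank (IntermediateField.adjoin F {y}) E =
      Module.finrank F E / (minpoly F x).natDegree := by
    rw [← hmul, hfr, hdeg, Nat.mul_div_cancel_left _ hpos]
  have hgen : Algebra.norm F (IntermediateField.AdjoinSimple.gen F y) =
      (-1) ^ (minpoly F x).natDegree * (minpoly F x).eval a := by
    have := Algebra.PowerBasis.norm_gen_eq_coeff_zero_minpoly
      (IntermediateField.adjoin.powerBasis (hint y))
    rw [IntermediateField.adjoin.powerBasis_gen, IntermediateField.adjoin.powerBasis_dim,
      IntermediateField.minpoly_gen, hdeg, hc0] at this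
    exact this
  have hneg : algebraMap F E a - x = algebraMap F E (-1) * y := by
    rw [map_neg, map_one, hy]; ring
  rw [hneg, map_mul, Algebra.norm_algebraMap, Algebra.norm_eq_norm_adjoin F y, hgen, hdiv, mul_pow,
    ← pow_mul, Nat.mul_div_cancel' (minpoly.degree_dvd (hint x)), ← mul_assoc, ← mul_pow]
  simp

/-- The lift of a multiplicative character to a finite extension through the norm. -/
noncomputable def normMulChar {F : Type*} (E : Type*) [Field F] [Field E] [Algebra F E]
    [Module.Finite F E] (χ : MulChar F ℂ) : MulChar E ℂ :=
  { toMonoidHom := χ.toMonoidHom.comp (Algebra.norm F)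
    map_nonunit' := fun x hx => by
      have : x = 0 := by simpa using hx
      subst this
      change χ (Algebra.norm F (0 : E)) = 0
      rw [Algebra.norm_zero, MulChar.map_zero] }

theorem normMulChar_apply {F E : Type*} [Field F] [Field E] [Algebra F E]
    [Module.Finite F E] (χ : MulChar F ℂ) (x : E) : normMulChar E χ x = χ (Algebra.norm F x) := rfl

theorem normMulChar_inv {F E : Type*} [Field F] [Field E] [Algebra F E]
    [Module.Finite F E] (χ : MulChar F ℂ) : (normMulChar E χ)⁻¹ = normMulChar E χ⁻¹ := by
  ext x
  have : Algebra.norm F (x : E)⁻¹ = (Algebra.norm F (x : E))⁻¹ := by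
    refine eq_inv_of_mul_eq_one_left ?_
    rw [← map_mul, inv_mul_cancel₀ x.ne_zero, map_one]
  rw [MulChar.inv_apply', normMulChar_apply, normMulChar_apply, MulChar.inv_apply', this]

theorem normMulChar_ne_one {F E : Type*} [Field F] [Field E] [Algebra F E] [Finite E]
    [Module.Finite F E] {χ : MulChar F ℂ} (hχ : χ ≠ 1) : normMulChar E χ ≠ 1 := by
  obtain ⟨a, ha⟩ := MulChar.ne_one_iff.mp hχ
  obtain ⟨b, hb⟩ := FiniteField.unitsMap_norm_surjective F E a
  refine MulChar.ne_one_iff.mpr ⟨b, ?_⟩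
  rw [normMulChar_apply]
  have : Algebra.norm F (b : E) = a := congrArg Units.val hb
  rwa [this]

theorem normMulChar_pow_eq_one {F E : Type*} [Field F] [Field E] [Algebra F E]
    [Module.Finite F E] {χ : MulChar F ℂ} {d : ℕ} (hχ : χ ^ d = 1) : normMulChar E χ ^ d = 1 := by
  ext x
  rw [MulChar.pow_apply_coe, normMulChar_apply, MulChar.one_apply_coe]
  have : IsUnit (Algebra.norm F (x : E)) := x.isUnit.map (Algebra.norm F)
  obtain ⟨u, hu⟩ := this
  rw [← hu, ← MulChar.pow_apply_coe, hχ, MulChar.one_apply_coe]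

/-- The completely multiplicative function `g ↦ χ(g(0)) χ⁻¹(g(-1)) χ⁻¹(g(-l))`. -/
noncomputable def evalChar {F : Type*} [Field F] (χ : MulChar F ℂ) (l : F) : F[X] →* ℂ where
  toFun g := χ (g.eval 0) * χ⁻¹ (g.eval (-1)) * χ⁻¹ (g.eval (-l))
  map_one' := by simp
  map_mul' g h := by simp only [eval_mul, map_mul]; ring

theorem evalChar_apply {F : Type*} [Field F] (χ : MulChar F ℂ) (l : F) (g : F[X]) :
    evalChar χ l g = χ (g.eval 0) * χ⁻¹ (g.eval (-1)) * χ⁻¹ (g.eval (-l)) := rfl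

/-- The quadratic `w` is 1 at 0 and vanishes at -1 and -l. Adding `C c * w` permutes the monic
polynomials of degree n ≥ 3 and moves only the value at 0, so averaging over `c` yields a full sum
of χ. -/
theorem lCoeff_evalChar_eq_zero {F : Type*} [Field F] [Fintype F] {χ : MulChar F ℂ} (hχ : χ ≠ 1)
    {l : F} (hl : l ≠ 0) {n : ℕ} (hn : 3 ≤ n) : lCoeff (evalChar χ l) n = 0 := by
  set w : F[X] := C l⁻¹ * ((X + C 1) * (X + C l)) with hw
  have w0 : w.eval 0 = 1 := by simp [hw, hl]
  have w1 : w.eval (-1) = 0 := by simp [hw]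
  have wl : w.eval (-l) = 0 := by simp [hw]
  have hwd : w.natDegree ≤ 2 := by rw [hw]; compute_degree
  have hshift : ∀ c : F, ∀ g ∈ monicFinset F n, g + C c * w ∈ monicFinset F n := by
    intro c g hg
    obtain ⟨h1, h2⟩ := mem_monicFinset.mp hg
    have hlt : (C c * w).natDegree < g.natDegree :=
      ((natDegree_C_mul_le c w).trans hwd).trans_lt (by lia)
    exact mem_monicFinset.mpr ⟨h1.add_of_left (degree_lt_degree hlt),
      (natDegree_add_eq_left_of_natDegree_lt hlt).trans h2⟩
  have htrans : ∀ c : F, lCoeff (evalChar χ l) n =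
      ∑ g ∈ monicFinset F n, evalChar χ l (g + C c * w) := by
    intro c
    symm
    refine Finset.sum_bij (fun g _ => g + C c * w) (hshift c) (fun _ _ _ _ h => add_right_cancel h)
      (fun g hg => ⟨g + C (-c) * w, hshift (-c) g hg, ?_⟩) (fun _ _ => rfl)
    rw [C_neg]; ring
  have hsum : (Fintype.card F : ℂ) * lCoeff (evalChar χ l) n = 0 := by
    rw [← nsmul_eq_mul, ← Finset.card_univ, ← Finset.sum_const,
      Finset.sum_congr rfl fun c _ => htrans c, Finset.sum_comm]
    refine Finset.sum_eq_zero fun g _ => ?_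
    simp only [evalChar_apply, eval_add, eval_mul, eval_C, w0, w1, wl, mul_one, mul_zero, add_zero]
    have h0 : ∑ c, χ (g.eval 0 + c) = 0 := by
      rw [← MulChar.sum_eq_zero_of_ne_one hχ]
      exact Equiv.sum_comp (Equiv.addLeft (g.eval 0)) χ
    rw [← Finset.sum_mul, ← Finset.sum_mul, h0, zero_mul, zero_mul]
  exact (mul_eq_zero.mp hsum).resolve_left (by exact_mod_cast Fintype.card_ne_zero)

theorem sum_evalChar_minpoly {F E : Type*} [Field F] [Field E] [Fintype E] [Algebra F E]
    [Module.Finite F E] (χ : MulChar F ℂ) (l : F) :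
    ∑ x : E, evalChar χ l (minpoly F x) ^ (Module.finrank F E / (minpoly F x).natDegree) =
      normMulChar E χ⁻¹ (-1) * ∑ x : E, normMulChar E χ x * (normMulChar E χ)⁻¹ (1 + x) *
        (normMulChar E χ)⁻¹ (algebraMap F E l + x) := by
  rw [Finset.mul_sum]
  refine Finset.sum_congr rfl fun x _ => ?_
  rw [evalChar_apply, mul_pow, mul_pow, ← map_pow, ← map_pow, ← map_pow,
    eval_minpoly_pow_eq_norm, eval_minpoly_pow_eq_norm, eval_minpoly_pow_eq_norm,
    ← normMulChar_apply, ← normMulChar_apply, ← normMulChar_apply, normMulChar_inv]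
  have e1 : algebraMap F E 0 - x = -1 * x := by rw [map_zero]; ring
  have e2 : algebraMap F E (-1) - x = -1 * (1 + x) := by rw [map_neg, map_one]; ring
  have e3 : algebraMap F E (-l) - x = -1 * (algebraMap F E l + x) := by rw [map_neg]; ring
  have e4 : normMulChar E χ (-1) * normMulChar E χ⁻¹ (-1) = 1 := by
    rw [← normMulChar_inv, MulChar.inv_apply', ← map_mul]; simp
  rw [e1, e2, e3, map_mul, map_mul, map_mul]
  linear_combination (normMulChar E χ x * normMulChar E χ⁻¹ (1 + x) *
    normMulChar E χ⁻¹ (algebraMap F E l + x) * normMulChar E χ⁻¹ (-1)) * e4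

/-! ### Weil's bound. -/

/-- Weil's bound for the character sum `∑ χ(t / ((1 + t)(l + t)))`. -/
theorem norm_sum_mulChar_le_two_sqrt {p : ℕ} [Fact p.Prime] {χ : MulChar (ZMod p) ℂ} (hχ : χ ≠ 1)
    {l : ZMod p} (hl : l ≠ 0) (hl1 : l ≠ 1) :
    ‖∑ t, χ t * χ⁻¹ (1 + t) * χ⁻¹ (l + t)‖ ≤ 2 * √p := by
  have hpp : p.Prime := Fact.out
  have hp2 : p ≠ 2 := by
    rintro rfl
    have : ∀ l : Fin 2, l ≠ 0 → l ≠ 1 → False := by decide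
    exact this l hl hl1
  have hp0 : (0 : ℝ) < p := by exact_mod_cast hpp.pos
  have hone : ∀ (E : Type) [Field E] [Finite E] (ξ : MulChar E ℂ), ‖ξ (-1)‖ = 1 := fun E _ _ ξ => by
    simpa using norm_mulChar_units ξ (-1)
  have hft : ∀ k : ℕ, Fintype (GaloisField p k) := fun k => Fintype.ofFinite _
  set ψ := evalChar χ l with hψ
  set S : ℕ → ℂ := fun k => ∑ x : GaloisField p k,
    ψ (minpoly (ZMod p) x) ^ (k / (minpoly (ZMod p) x).natDegree) with hS
  have hN : ∀ n : ℕ, n * lCoeff ψ n = ∑ k ∈ Finset.Icc 1 n, S k * lCoeff ψ (n - k) := by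
    intro n
    rw [nat_mul_lCoeff]
    refine Finset.sum_congr rfl fun k hk => ?_
    rw [Finset.mem_Icc] at hk
    have hfr : Module.finrank (ZMod p) (GaloisField p k) = k := GaloisField.finrank p (by lia)
    have := primePowerSum_eq_sum (E := GaloisField p k) ψ (n := n) (by lia)
    rw [hfr] at this
    rw [this]
  obtain ⟨s, hs⟩ := IsAlgClosed.exists_eq_mul_self (lCoeff ψ 1 ^ 2 - 4 * lCoeff ψ 2)
  set α := (-lCoeff ψ 1 + s) / 2 with hα
  set β := (-lCoeff ψ 1 - s) / 2 with hβ
  have h1 : lCoeff ψ 1 = -(α + β) := by rw [hα, hβ]; ring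
  have h2 : lCoeff ψ 2 = α * β := by rw [hα, hβ]; linear_combination -hs / 4
  have hSk := eq_neg_pow_add_pow_of_newton (lCoeff_zero ψ) h1 h2
    (fun n hn => lCoeff_evalChar_eq_zero hχ hl hn) hN
  -- The exponent d = p - 1 kills every norm lift of χ and is -1 in characteristic p, so the
  -- constant depends on p but not on `m`.
  have hbound : ∀ m : ℕ, 1 ≤ m → ‖S (2 * m)‖ ≤ (14 * ((p - 1 : ℕ) : ℝ) + 21) * (p : ℝ) ^ m := by
    intro m hm
    classical
    have hfr : Module.finrank (ZMod p) (GaloisField p (2 * m)) = 2 * m :=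
      GaloisField.finrank p (by lia)
    have hcard : Fintype.card (GaloisField p (2 * m)) = (p ^ m) ^ 2 := by
      rw [← Nat.card_eq_fintype_card, GaloisField.card p _ (by lia), ← pow_mul, mul_comm]
    have := sum_evalChar_minpoly (E := GaloisField p (2 * m)) χ l
    rw [hfr] at this
    rw [hS]
    simp only
    rw [hψ, this, norm_mul, hone, one_mul]
    refine norm_sum_mulChar_le hcard hp2 (normMulChar_ne_one hχ) (normMulChar_pow_eq_one ?_) ?_ ?_ ?_
    · ext u
      rw [MulChar.pow_apply_coe, ← map_pow, ← Units.val_pow_eq_pow_val,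
        ZMod.units_pow_card_sub_one_eq_one]
      simp
    · rw [Nat.cast_sub hpp.one_lt.le, CharP.cast_eq_zero]
      simp
    · exact (_root_.map_ne_zero _).mpr hl
    · rw [← map_one (algebraMap (ZMod p) (GaloisField p (2 * m)))]
      exact fun h => hl1 ((algebraMap (ZMod p) (GaloisField p (2 * m))).injective h)
  have hAB : ∀ m : ℕ, 1 ≤ m →
      ‖(α ^ 2) ^ m + (β ^ 2) ^ m‖ ≤ (14 * ((p - 1 : ℕ) : ℝ) + 21) * (p : ℝ) ^ m := by
    intro m hm
    have := hbound m hm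
    rwa [hSk _ (by lia), norm_neg, pow_mul, pow_mul] at this
  have hA : ‖α‖ ≤ √p := by
    refine Real.le_sqrt_of_sq_le ?_
    rw [← norm_pow]
    exact norm_le_of_forall_norm_pow_add_pow_le hp0 hAB
  have hB : ‖β‖ ≤ √p := by
    refine Real.le_sqrt_of_sq_le ?_
    rw [← norm_pow]
    exact norm_le_of_forall_norm_pow_add_pow_le (B := α ^ 2) hp0
      fun m hm => by rw [add_comm]; exact hAB m hm
  have hlc : lCoeff ψ 1 = χ⁻¹ (-1) * ∑ t, χ t * χ⁻¹ (1 + t) * χ⁻¹ (l + t) := by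
    rw [lCoeff_one, Finset.mul_sum]
    refine Finset.sum_congr rfl fun x _ => ?_
    rw [hψ, evalChar_apply]
    simp only [eval_sub, eval_X, eval_C]
    have e1 : (0 : ZMod p) - x = -1 * x := by ring
    have e2 : (-1 : ZMod p) - x = -1 * (1 + x) := by ring
    have e3 : -l - x = -1 * (l + x) := by ring
    have e4 : χ (-1) * χ⁻¹ (-1) = 1 := by
      rw [MulChar.inv_apply', ← map_mul]; simp
    rw [e1, e2, e3, map_mul, map_mul, map_mul]
    linear_combination (χ x * χ⁻¹ (1 + x) * χ⁻¹ (l + x) * χ⁻¹ (-1)) * e4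
  calc ‖∑ t, χ t * χ⁻¹ (1 + t) * χ⁻¹ (l + t)‖ = ‖lCoeff ψ 1‖ := by
        rw [hlc, norm_mul, hone, one_mul]
    _ = ‖α + β‖ := by rw [h1, norm_neg]
    _ ≤ ‖α‖ + ‖β‖ := norm_add_le _ _
    _ ≤ _ := by linarith

/-! ### Evaluating K by Ramanujan, Gauss and Jacobi sums. -/

theorem sum_units_stdAddChar_mul {p : ℕ} [Fact p.Prime] (b : ZMod p) :
    ∑ a : (ZMod p)ˣ, ZMod.stdAddChar ((a : ZMod p) * b) = (if b = 0 then (p : ℂ) else 0) - 1 := by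
  have h := AddChar.sum_mulShift b (ZMod.isPrimitive_stdAddChar p)
  rw [sum_eq_zero_add_sum_units, zero_mul, AddChar.map_zero_eq_one, ZMod.card] at h
  push_cast at h
  linear_combination h

theorem sum_units_mulChar_mul_stdAddChar {p : ℕ} [Fact p.Prime] {χ : MulChar (ZMod p) ℂ}
    (hχ : χ ≠ 1) (b : ZMod p) :
    ∑ a : (ZMod p)ˣ, χ a * ZMod.stdAddChar ((a : ZMod p) * b) =
      χ⁻¹ b * gaussSum χ ZMod.stdAddChar := by
  have h : ∑ a : (ZMod p)ˣ, χ a * ZMod.stdAddChar ((a : ZMod p) * b) =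
      ∑ a, χ a * ZMod.stdAddChar (a * b) := by
    rw [sum_eq_zero_add_sum_units fun a : ZMod p => χ a * ZMod.stdAddChar (a * b),
      MulChar.map_zero, zero_mul, zero_add]
  rw [h]
  by_cases hb : b = 0
  · subst hb
    rw [MulChar.map_zero, zero_mul]
    simpa using MulChar.sum_eq_zero_of_ne_one hχ
  · have := gaussSum_mulShift_eq χ ZMod.stdAddChar (Units.mk0 b hb)
    rw [Units.val_mk0] at this
    rw [← this, gaussSum]
    refine Finset.sum_congr rfl fun a _ => ?_
    rw [AddChar.mulShift_apply, mul_comm b]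

theorem kloostermanCorrelation_eq_sum {p : ℕ} [Fact p.Prime] (n₁ n₂ : ℤ)
    (χ : DirichletCharacter ℂ p) :
    kloostermanCorrelation n₁ n₂ χ = ∑ d : (ZMod p)ˣ, ∑ d' : (ZMod p)ˣ,
      ZMod.stdAddChar ((n₁ : ZMod p) * (d : ZMod p) + (n₂ : ZMod p) * (d' : ZMod p)) *
        ∑ a : (ZMod p)ˣ, χ a * ZMod.stdAddChar ((a : ZMod p) *
          (((d⁻¹ : (ZMod p)ˣ) : ZMod p) + ((d'⁻¹ : (ZMod p)ˣ) : ZMod p))) := by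
  simp only [kloostermanCorrelation, kloostermanSum, Finset.mul_sum, Finset.sum_mul]
  rw [Finset.sum_comm, Finset.sum_congr rfl fun d _ => Finset.sum_comm, Finset.sum_comm]
  refine Finset.sum_congr rfl fun d _ => Finset.sum_congr rfl fun d' _ =>
    Finset.sum_congr rfl fun a _ => ?_
  simp only [mul_add, AddChar.map_add_eq_mul]
  ring

theorem kloostermanCorrelation_one {p : ℕ} [Fact p.Prime] {n₁ n₂ : ℤ} (h₁ : (n₁ : ZMod p) ≠ 0)
    (h₂ : (n₂ : ZMod p) ≠ 0) :
    kloostermanCorrelation n₁ n₂ (1 : DirichletCharacter ℂ p) =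
      p * ((if (n₁ : ZMod p) - n₂ = 0 then (p : ℂ) else 0) - 1) - 1 := by
  have hinner : ∀ d d' : (ZMod p)ˣ, ∑ a : (ZMod p)ˣ, (1 : DirichletCharacter ℂ p) a *
      ZMod.stdAddChar ((a : ZMod p) * (((d⁻¹ : (ZMod p)ˣ) : ZMod p) + ((d'⁻¹ : (ZMod p)ˣ) : ZMod p)))
      = (if -d = d' then (p : ℂ) else 0) - 1 := by
    intro d d'
    simp only [MulChar.one_apply_coe, one_mul]
    rw [sum_units_stdAddChar_mul]
    congr 2
    rw [← Units.val_inj, Units.val_neg, Units.val_inv_eq_inv_val, Units.val_inv_eq_inv_val,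
      add_eq_zero_iff_eq_neg, ← inv_neg, inv_inj, eq_iff_iff, eq_comm, neg_eq_iff_eq_neg, eq_comm]
  have hunit : ∀ {n : ZMod p}, n ≠ 0 → ∑ d : (ZMod p)ˣ, ZMod.stdAddChar (n * (d : ZMod p)) = -1 := by
    intro n hn
    simp only [mul_comm n]
    rw [sum_units_stdAddChar_mul, if_neg hn, zero_sub]
  rw [kloostermanCorrelation_eq_sum]
  simp only [hinner, mul_sub, mul_one, mul_ite, mul_zero, Finset.sum_sub_distrib]
  simp only [Finset.sum_ite_eq, Finset.mem_univ, if_true]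
  simp only [AddChar.map_add_eq_mul]
  simp only [← Finset.mul_sum, ← Finset.sum_mul]
  rw [hunit h₁, hunit h₂]
  have : ∀ d : (ZMod p)ˣ, ZMod.stdAddChar ((n₁ : ZMod p) * (d : ZMod p)) *
      ZMod.stdAddChar ((n₂ : ZMod p) * ((-d : (ZMod p)ˣ) : ZMod p)) =
      ZMod.stdAddChar ((d : ZMod p) * ((n₁ : ZMod p) - (n₂ : ZMod p))) := fun d => by
    rw [← AddChar.map_add_eq_mul, Units.val_neg]
    congr 1; ring
  simp only [this]
  rw [sum_units_stdAddChar_mul]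
  split_ifs <;> ring

theorem kloostermanCorrelation_eq_gaussSum_sq {p : ℕ} [Fact p.Prime] {n₁ n₂ : ℤ}
    (h₂ : (n₂ : ZMod p) ≠ 0) {χ : DirichletCharacter ℂ p} (hχ : χ ≠ 1) :
    kloostermanCorrelation n₁ n₂ χ = gaussSum χ ZMod.stdAddChar ^ 2 * (χ⁻¹ (n₂ : ZMod p) *
      ∑ t, χ t * χ⁻¹ (1 + t) * χ⁻¹ ((n₁ : ZMod p) / n₂ + t)) := by
  have hinv : ∀ x : (ZMod p)ˣ, χ⁻¹ (((x⁻¹ : (ZMod p)ˣ) : ZMod p)) = χ x := fun x => by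
    rw [MulChar.inv_apply', Units.val_inv_eq_inv_val, inv_inv]
  have hterm : ∀ d t : (ZMod p)ˣ,
      ZMod.stdAddChar ((n₁ : ZMod p) * (d : ZMod p) + (n₂ : ZMod p) * ((d * t : (ZMod p)ˣ) : ZMod p)) *
        (χ⁻¹ (((d⁻¹ : (ZMod p)ˣ) : ZMod p) + (((d * t)⁻¹ : (ZMod p)ˣ) : ZMod p)) *
          gaussSum χ ZMod.stdAddChar) =
      gaussSum χ ZMod.stdAddChar * (χ t * χ⁻¹ (1 + t)) *
        (χ d * ZMod.stdAddChar ((d : ZMod p) * ((n₁ : ZMod p) + (n₂ : ZMod p) * (t : ZMod p)))) := by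
    intro d t
    have e1 : ((d⁻¹ : (ZMod p)ˣ) : ZMod p) + (((d * t)⁻¹ : (ZMod p)ˣ) : ZMod p) =
        ((d⁻¹ : (ZMod p)ˣ) : ZMod p) * (((t⁻¹ : (ZMod p)ˣ) : ZMod p) * (1 + t)) := by
      rw [mul_add, Units.inv_mul, mul_inv, Units.val_mul]; ring
    have e2 : (n₁ : ZMod p) * (d : ZMod p) + (n₂ : ZMod p) * ((d * t : (ZMod p)ˣ) : ZMod p) =
        d * ((n₁ : ZMod p) + (n₂ : ZMod p) * (t : ZMod p)) := by
      rw [Units.val_mul]; ring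
    rw [e1, e2, map_mul χ⁻¹, map_mul χ⁻¹, hinv, hinv]
    ring
  rw [kloostermanCorrelation_eq_sum]
  simp only [sum_units_mulChar_mul_stdAddChar hχ]
  have hsub : ∀ d : (ZMod p)ˣ, ∑ d' : (ZMod p)ˣ,
      ZMod.stdAddChar ((n₁ : ZMod p) * (d : ZMod p) + (n₂ : ZMod p) * (d' : ZMod p)) *
        (χ⁻¹ (((d⁻¹ : (ZMod p)ˣ) : ZMod p) + ((d'⁻¹ : (ZMod p)ˣ) : ZMod p)) *
          gaussSum χ ZMod.stdAddChar) = ∑ t : (ZMod p)ˣ,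
      gaussSum χ ZMod.stdAddChar * (χ t * χ⁻¹ (1 + t)) *
        (χ d * ZMod.stdAddChar ((d : ZMod p) * ((n₁ : ZMod p) + (n₂ : ZMod p) * (t : ZMod p)))) := by
    intro d
    -- Substitute d' = d t.
    rw [← Equiv.sum_comp (Equiv.mulLeft d)]
    exact Finset.sum_congr rfl fun t _ => hterm d t
  simp only [hsub]
  rw [Finset.sum_comm, sum_eq_zero_add_sum_units fun t : ZMod p =>
    χ t * χ⁻¹ (1 + t) * χ⁻¹ ((n₁ : ZMod p) / n₂ + t), MulChar.map_zero, zero_mul, zero_mul, zero_add,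
    Finset.mul_sum, Finset.mul_sum]
  refine Finset.sum_congr rfl fun t _ => ?_
  rw [← Finset.mul_sum, sum_units_mulChar_mul_stdAddChar hχ]
  have e : (n₁ : ZMod p) + n₂ * t = n₂ * (n₁ / n₂ + t) := by
    rw [mul_add, mul_div_cancel₀ _ h₂]
  rw [e, map_mul]
  ring

theorem norm_gaussSum_sq {p : ℕ} [Fact p.Prime] {χ : MulChar (ZMod p) ℂ} (hχ : χ ≠ 1) :
    ‖gaussSum χ ZMod.stdAddChar ^ 2‖ = p := by
  have h := gaussSum_mul_gaussSum_eq_card hχ (ZMod.isPrimitive_stdAddChar p)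
  rw [← star_gaussSum_eq, ZMod.card] at h
  have h' := congrArg norm h
  rw [norm_mul, norm_star, Complex.norm_natCast] at h'
  rw [norm_pow, sq, h']

theorem norm_jacobiSum {p : ℕ} [Fact p.Prime] {χ φ : MulChar (ZMod p) ℂ} (hχ : χ ≠ 1)
    (hφ : φ ≠ 1) (hχφ : χ * φ ≠ 1) : ‖jacobiSum χ φ‖ = √p := by
  have hpp : p.Prime := Fact.out
  have hchar : ringChar ℂ ≠ ringChar (ZMod p) := by
    rw [ZMod.ringChar_zmod_n, ringChar.eq_zero]
    exact hpp.ne_zero.symm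
  have h := jacobiSum_mul_jacobiSum_inv hchar hχ hφ hχφ
  have hstar : jacobiSum χ⁻¹ φ⁻¹ = star (jacobiSum χ φ) := by
    simp only [jacobiSum, star_sum, star_mul']
    simp only [MulChar.star_apply']
  rw [hstar, ZMod.card] at h
  have h' := congrArg norm h
  rw [norm_mul, norm_star, Complex.norm_natCast] at h'
  rw [← h', Real.sqrt_mul_self (norm_nonneg _)]

/-- Under t ↦ -t this is χ(-1) J(χ, χ⁻²), of norm √p, or of norm 1 when χ² = 1. -/
theorem norm_sum_mulChar_one_le {p : ℕ} [Fact p.Prime] {χ : MulChar (ZMod p) ℂ} (hχ : χ ≠ 1) :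
    ‖∑ t, χ t * χ⁻¹ (1 + t) * χ⁻¹ (1 + t)‖ ≤ √p := by
  have hpp : p.Prime := Fact.out
  have e : ∑ t, χ t * χ⁻¹ (1 + t) * χ⁻¹ (1 + t) = χ (-1) * jacobiSum χ (χ⁻¹ * χ⁻¹) := by
    rw [jacobiSum, Finset.mul_sum, ← Equiv.sum_comp (Equiv.neg (ZMod p))]
    refine Finset.sum_congr rfl fun t _ => ?_
    rw [Equiv.neg_apply, ← sub_eq_add_neg, MulChar.mul_apply, ← neg_one_mul t, map_mul]
    ring_nf
  have h1 : ‖χ (-1)‖ = 1 := by simpa using norm_mulChar_units χ (-1)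
  rw [e, norm_mul, h1, one_mul]
  by_cases h : χ⁻¹ * χ⁻¹ = 1
  · rw [h, jacobiSum_comm, jacobiSum_one_nontrivial hχ, norm_neg, norm_one]
    rw [Real.one_le_sqrt]
    exact_mod_cast hpp.one_lt.le
  · refine (norm_jacobiSum hχ h ?_).le
    rw [mul_inv_cancel_left]
    exact inv_ne_one.mpr hχ

theorem norm_kloostermanCorrelation_le {p : ℕ} [Fact p.Prime] {n₁ n₂ : ℤ}
    (h₁ : (n₁ : ZMod p) ≠ 0) (h₂ : (n₂ : ZMod p) ≠ 0) {χ : DirichletCharacter ℂ p} (hχ : χ ≠ 1) :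
    ‖kloostermanCorrelation n₁ n₂ χ‖ ≤ 2 * (p : ℝ) ^ (3 / 2 : ℝ) := by
  have hpp : p.Prime := Fact.out
  have hp0 : (0 : ℝ) < p := by exact_mod_cast hpp.pos
  have hS : ‖∑ t, χ t * χ⁻¹ (1 + t) * χ⁻¹ ((n₁ : ZMod p) / n₂ + t)‖ ≤ 2 * √p := by
    by_cases hl : (n₁ : ZMod p) / n₂ = 1
    · rw [hl]
      have := Real.sqrt_nonneg p
      linarith [norm_sum_mulChar_one_le hχ]
    · exact norm_sum_mulChar_le_two_sqrt hχ (div_ne_zero h₁ h₂) hl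
  rw [kloostermanCorrelation_eq_gaussSum_sq h₂ hχ, norm_mul, norm_mul, norm_gaussSum_sq hχ]
  have h32 : (p : ℝ) ^ (3 / 2 : ℝ) = p * √p := by
    rw [Real.sqrt_eq_rpow]
    nth_rewrite 2 [← Real.rpow_one (p : ℝ)]
    rw [← Real.rpow_add hp0]
    norm_num
  rw [h32]
  calc (p : ℝ) * (‖χ⁻¹ (n₂ : ZMod p)‖ *
        ‖∑ t, χ t * χ⁻¹ (1 + t) * χ⁻¹ ((n₁ : ZMod p) / n₂ + t)‖) ≤ p * (1 * (2 * √p)) := by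
        gcongr
        exact norm_mulChar_le_one _ _
    _ = _ := by ring

theorem lemma6p3 :
    (∀ (N : ℕ) [Fact N.Prime] (n₁ n₂ : ℤ), ¬ (N : ℤ) ∣ n₁ → ¬ (N : ℤ) ∣ n₂ →
      kloostermanCorrelation n₁ n₂ (1 : DirichletCharacter ℂ N) =
        if n₁ - n₂ ≡ 0 [ZMOD (N : ℤ)] then
          (Nat.totient N : ℂ) ^ 2 + (Nat.totient N : ℂ) - 1
        else
          -(Nat.totient N : ℂ) - 2) ∧
    (∀ ε : ℝ, 0 < ε → ∃ C : ℝ, ∀ (N : ℕ) [Fact N.Prime] (n₁ n₂ : ℤ),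
      ¬ (N : ℤ) ∣ n₁ → ¬ (N : ℤ) ∣ n₂ →
      ∀ χ : DirichletCharacter ℂ N, χ ≠ 1 →
        ‖kloostermanCorrelation n₁ n₂ χ‖ ≤ C * (N : ℝ) ^ (3 / 2 + ε)) := by
  constructor
  · intro N _ n₁ n₂ h₁ h₂
    have hpp : N.Prime := Fact.out
    rw [kloostermanCorrelation_one (mt (ZMod.intCast_zmod_eq_zero_iff_dvd _ N).mp h₁)
      (mt (ZMod.intCast_zmod_eq_zero_iff_dvd _ N).mp h₂), Nat.totient_prime hpp,
      Nat.cast_sub hpp.one_lt.le, Nat.cast_one]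
    have hiff : (n₁ : ZMod N) - n₂ = 0 ↔ n₁ - n₂ ≡ 0 [ZMOD (N : ℤ)] := by
      rw [← ZMod.intCast_eq_intCast_iff]; push_cast; rfl
    simp only [hiff]
    split_ifs <;> ring
  · intro ε hε
    -- The bound 2 N^(3/2) holds outright; ε only enlarges the right side, as N ≥ 1.
    refine ⟨2, fun N _ n₁ n₂ h₁ h₂ χ hχ => ?_⟩
    refine (norm_kloostermanCorrelation_le (mt (ZMod.intCast_zmod_eq_zero_iff_dvd _ N).mp h₁)
      (mt (ZMod.intCast_zmod_eq_zero_iff_dvd _ N).mp h₂) hχ).trans ?_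
    have hN : (1 : ℝ) ≤ N := by exact_mod_cast (Fact.out : N.Prime).one_lt.le
    gcongr
    linarith
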